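/- For $j\ge 0$ let $h_j(t)=c_j\,e^{\pi t^2}\frac{d^j}{dt^j}\big(e^{-2\pi t^2}\big)$, $t\in\mathbb{R}$, be the $j$-th Hermite function, where the real constant $c_j$, of sign $(-1)^j$, is chosen such that $\|h_j\|_{L^2(\mathbb{R})}=1$; in particular $h_0(t)=2^{1/4}e^{-\pi t^2}$. For $f,g\in L^2(\mathbb{R})$ let $$W(f,g)(x,\xi)=\int_{\mathbb{R}} f\big(x+\tfrac t2\big)\,\overline{g\big(x-\tfrac t2\big)}\,e^{-2\pi i\xi t}\,dt,\qquad (x,\xi)\in\mathbb{R}^2,$$ be their Wigner distribution. Let $f$ and $g$ be finite linear combinations, with complex coefficients, of Hermite functions, and assume that at least one of $f,g$ is a linear combination of $h_0$ and $h_1$. Unless $f$ and $g$ are both (complex) multiples of $h_0$, the Wigner distribution $W(f,g)$ has a zero, i.e. there is $(x,\xi)\in\mathbb{R}^2$ with $W(f,g)(x,\xi)=0$. -/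

import Mathlib

open scoped ComplexConjugate

/-- The unnormalized `j`-th Hermite function
`(-1)^j e^{π t²} (d/dt)^j e^{-2π t²}` on the real line. -/
noncomputable def rawHermite (j : ℕ) (t : ℝ) : ℝ :=
  (-1) ^ j * Real.exp (Real.pi * t ^ 2) *
    iteratedDeriv j (fun s : ℝ => Real.exp (-2 * Real.pi * s ^ 2)) t

/-- The `j`-th Hermite function `h_j = c_j e^{π t²} (d/dt)^j e^{-2π t²}`, where the constant
`c_j` is such that `‖h_j‖₂ = 1` (and its sign is `(-1)^j`, so that the leading coefficient of
the polynomial factor is positive). -/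
noncomputable def hermiteFun (j : ℕ) : ℝ → ℂ := fun t =>
  ((rawHermite j t / Real.sqrt (∫ s : ℝ, rawHermite j s ^ 2) : ℝ) : ℂ)

/-- The (cross-)Wigner distribution
`W(f,g)(x,ξ) = ∫ f(x + t/2) conj(g(x - t/2)) e^{-2π i ξ t} dt` in dimension one. -/
noncomputable def wigner (f g : ℝ → ℂ) (x ξ : ℝ) : ℂ :=
  ∫ t : ℝ, f (x + t / 2) * conj (g (x - t / 2)) *
    Complex.exp (-2 * Real.pi * Complex.I * ξ * t)

/-- `h_0` is the normalized Gaussian `2^{1/4} e^{-π t²}`. -/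
theorem hermiteFun_zero (t : ℝ) :
    hermiteFun 0 t = (((2 : ℝ) ^ (1 / 4 : ℝ) * Real.exp (-Real.pi * t ^ 2) : ℝ) : ℂ) := by
  have h0 : ∀ s : ℝ, rawHermite 0 s = Real.exp (-Real.pi * s ^ 2) := by
    intro s
    simp only [rawHermite, pow_zero, one_mul, iteratedDeriv_zero]
    rw [← Real.exp_add]
    congr 1
    ring
  have h1 : ∀ s : ℝ, rawHermite 0 s ^ 2 = Real.exp (-(2 * Real.pi) * s ^ 2) := by
    intro s
    rw [h0, ← Real.exp_nat_mul]
    congr 1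
    push_cast
    ring
  have h2 : (∫ s : ℝ, rawHermite 0 s ^ 2) = (2 : ℝ) ^ (-(1 / 2) : ℝ) := by
    simp_rw [h1]
    rw [integral_gaussian, Real.sqrt_eq_rpow, Real.rpow_neg (by norm_num),
      ← Real.inv_rpow (by norm_num)]
    congr 1
    field_simp
  unfold hermiteFun
  rw [h2, h0, Real.sqrt_eq_rpow, ← Real.rpow_mul (by norm_num), div_eq_mul_inv,
    ← Real.rpow_neg (by norm_num), mul_comm]
  norm_num

/-! Write f = (a + bt)e^{-πt²}, g = q(t)e^{-πt²}, z = x + iξ, and let Q be q with conjugated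
coefficients. Since x + t/2 = 2x - (x - t/2), the Wigner integrand is a polynomial in x - t/2 times
a modulated Gaussian. Integration by parts (`gaussMoment_X_mul`) evaluates such integrals: up to the
common factor `gaussMoment x ξ 1`, they turn Q into a polynomial G(z), its Gaussian transform with c
= 1/(4π). As 2x - z = conj z, a zero of W(f,g) arises wherever (a + b conj z) G(z) = (b/4π) G'(z)
(`wigner_affine_polyGauss`).

If b = 0, a root of G is needed, and G has one once q is nonconstant. If b ≠ 0 and G ≠ 0, the
equation is the critical point equation of |G(z)|² exp(-4π|z + conj(a/b)|²) where G(z) ≠ 0; this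
function decays at infinity, hence attains a positive maximum
(`exists_conj_mul_eval_eq_derivative`). -/

/-! ### Gaussian Appell polynomials and the associated transform -/

/-- The Appell sequence `1, X, X ^ 2 + c, …` attached to a Gaussian weight of variance `c`. -/
noncomputable def gaussAppell (c : ℂ) : ℕ → Polynomial ℂ
  | 0 => 1
  | m + 1 => Polynomial.X * gaussAppell c m +
      Polynomial.C c * Polynomial.derivative (gaussAppell c m)

/-- The additive map sending `X ^ m` to the `m`-th Gaussian Appell polynomial. -/
noncomputable def gaussTransform (c : ℂ) (P : Polynomial ℂ) : Polynomial ℂ :=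
  P.sum fun m a => Polynomial.C a * gaussAppell c m

open Polynomial in
-- The Appell property makes the recursion p_{m+2} = X p_{m+1} + c(m+1) p_m, the one that
-- integration by parts yields for moments.
theorem derivative_gaussAppell_succ (c : ℂ) (m : ℕ) :
    derivative (gaussAppell c (m + 1)) = ((m + 1 : ℕ) : ℂ[X]) * gaussAppell c m := by
  induction m with
  | zero => simp [gaussAppell]
  | succ m ih =>
    rw [gaussAppell, derivative_add, derivative_mul, derivative_mul, ih, derivative_X,
      derivative_C, derivative_mul, derivative_natCast, gaussAppell]
    push_cast
    ring

theorem natDegree_gaussAppell_le (c : ℂ) (m : ℕ) : (gaussAppell c m).natDegree ≤ m := by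
  induction m with
  | zero => simp [gaussAppell]
  | succ m ih =>
    refine Polynomial.natDegree_add_le_of_degree_le ?_ ?_
    · refine (Polynomial.natDegree_mul_le).trans ?_
      rw [Polynomial.natDegree_X]
      omega
    · refine (Polynomial.natDegree_C_mul_le _ _).trans ?_
      exact (Polynomial.natDegree_derivative_le _).trans (by omega)

theorem coeff_gaussAppell_self (c : ℂ) (m : ℕ) : (gaussAppell c m).coeff m = 1 := by
  induction m with
  | zero => simp [gaussAppell]
  | succ m ih =>
    have h : (Polynomial.derivative (gaussAppell c m)).coeff (m + 1) = 0 := by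
      apply Polynomial.coeff_eq_zero_of_natDegree_lt
      have h1 := Polynomial.natDegree_derivative_le (gaussAppell c m)
      have h2 := natDegree_gaussAppell_le c m
      omega
    rw [gaussAppell, Polynomial.coeff_add, Polynomial.coeff_X_mul, ih, Polynomial.coeff_C_mul, h]
    simp

theorem gaussTransform_add (c : ℂ) (P Q : Polynomial ℂ) :
    gaussTransform c (P + Q) = gaussTransform c P + gaussTransform c Q := by
  unfold gaussTransform
  exact Polynomial.sum_add_index _ _ _ (by simp) (by intros; simp [add_mul])

theorem gaussTransform_monomial (c : ℂ) (m : ℕ) (a : ℂ) :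
    gaussTransform c (Polynomial.monomial m a) = Polynomial.C a * gaussAppell c m := by
  unfold gaussTransform
  exact Polynomial.sum_monomial_index _ _ (by simp)

/-- The transform intertwines X with X + c d/dX; this is where G' enters the Wigner formula. -/
theorem gaussTransform_X_mul (c : ℂ) (P : Polynomial ℂ) :
    gaussTransform c (Polynomial.X * P) = Polynomial.X * gaussTransform c P +
      Polynomial.C c * Polynomial.derivative (gaussTransform c P) := by
  induction P using Polynomial.induction_on' with
  | add p q hp hq =>
    rw [mul_add, gaussTransform_add, hp, hq, gaussTransform_add, Polynomial.derivative_add]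
    ring
  | monomial n a =>
    rw [Polynomial.X_mul_monomial, gaussTransform_monomial, gaussTransform_monomial, gaussAppell,
      Polynomial.derivative_C_mul]
    ring

/-- Only lower-order terms are added to P, so a nonconstant P keeps a nonconstant transform. -/
theorem coeff_gaussTransform_natDegree (c : ℂ) (P : Polynomial ℂ) :
    (gaussTransform c P).coeff P.natDegree = P.leadingCoeff := by
  unfold gaussTransform
  rw [Polynomial.sum_over_range _ (by simp), Polynomial.finsetSum_coeff,
    Finset.sum_range_succ, Finset.sum_eq_zero, zero_add, Polynomial.coeff_C_mul,
    coeff_gaussAppell_self, mul_one]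
  · rfl
  · intro m hm
    rw [Polynomial.coeff_C_mul, Polynomial.coeff_eq_zero_of_natDegree_lt (p := gaussAppell c m),
      mul_zero]
    exact (natDegree_gaussAppell_le c m).trans_lt (Finset.mem_range.1 hm)

/-! ### Moments of modulated Gaussians -/

/-- A Gaussian modulated by a character. -/
noncomputable def gaussWave (ξ t : ℝ) : ℂ :=
  Complex.exp (-(Real.pi / 2) * t ^ 2 - 2 * Real.pi * Complex.I * ξ * t)

theorem norm_gaussWave (ξ t : ℝ) : ‖gaussWave ξ t‖ = Real.exp (-(Real.pi / 2) * t ^ 2) := by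
  have h : (-(Real.pi / 2) * t ^ 2 - 2 * Real.pi * Complex.I * ξ * t : ℂ) =
      ((-(Real.pi / 2) * t ^ 2 : ℝ) : ℂ) + ((-(2 * Real.pi * ξ * t) : ℝ) : ℂ) * Complex.I := by
    push_cast
    ring
  rw [gaussWave, h, Complex.exp_add, norm_mul, Complex.norm_exp_ofReal_mul_I, mul_one,
    Complex.norm_exp_ofReal]

theorem continuous_gaussWave (ξ : ℝ) : Continuous (gaussWave ξ) := by
  unfold gaussWave
  fun_prop

theorem integrable_pow_mul_gaussWave (ξ : ℝ) (m : ℕ) :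
    MeasureTheory.Integrable fun t : ℝ => (t : ℂ) ^ m * gaussWave ξ t := by
  have h := integrable_rpow_mul_exp_neg_mul_sq (b := Real.pi / 2) (by positivity)
    (s := (m : ℝ)) (by have : (0 : ℝ) ≤ m := m.cast_nonneg
                       linarith)
  refine h.mono ?_ (Filter.Eventually.of_forall fun t => ?_)
  · exact (by have := continuous_gaussWave ξ; fun_prop : Continuous _).aestronglyMeasurable
  · rw [norm_mul, norm_gaussWave, norm_mul, Real.rpow_natCast, Real.norm_eq_abs (Real.exp _),
      Real.abs_exp, norm_pow, norm_pow, Complex.norm_real]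

theorem integrable_eval_mul_gaussWave (ξ : ℝ) (P : Polynomial ℂ) :
    MeasureTheory.Integrable fun t : ℝ => P.eval (t : ℂ) * gaussWave ξ t := by
  induction P using Polynomial.induction_on' with
  | add p q hp hq =>
    simp only [Polynomial.eval_add, add_mul]
    exact hp.add hq
  | monomial n a =>
    simpa [mul_assoc] using (integrable_pow_mul_gaussWave ξ n).const_mul a

theorem integrable_eval_shift_mul_gaussWave (x ξ : ℝ) (P : Polynomial ℂ) :
    MeasureTheory.Integrable fun t : ℝ => P.eval ((x : ℂ) - t / 2) * gaussWave ξ t := by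
  have h := integrable_eval_mul_gaussWave ξ
    (P.comp (Polynomial.C (x : ℂ) - Polynomial.C (1 / 2) * Polynomial.X))
  refine h.congr (Filter.Eventually.of_forall fun t => ?_)
  simp only [Polynomial.eval_comp, Polynomial.eval_sub, Polynomial.eval_mul, Polynomial.eval_C,
    Polynomial.eval_X]
  ring_nf

/-- The integral of a polynomial in `x - t / 2` against a modulated Gaussian. -/
noncomputable def gaussMoment (x ξ : ℝ) (P : Polynomial ℂ) : ℂ :=
  ∫ t : ℝ, P.eval ((x : ℂ) - t / 2) * gaussWave ξ t

theorem gaussMoment_add (x ξ : ℝ) (P Q : Polynomial ℂ) :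
    gaussMoment x ξ (P + Q) = gaussMoment x ξ P + gaussMoment x ξ Q := by
  simp only [gaussMoment, Polynomial.eval_add, add_mul]
  exact MeasureTheory.integral_add (integrable_eval_shift_mul_gaussWave x ξ P)
    (integrable_eval_shift_mul_gaussWave x ξ Q)

theorem gaussMoment_C_mul (x ξ : ℝ) (a : ℂ) (P : Polynomial ℂ) :
    gaussMoment x ξ (Polynomial.C a * P) = a * gaussMoment x ξ P := by
  simp only [gaussMoment, Polynomial.eval_mul, Polynomial.eval_C, mul_assoc]
  exact MeasureTheory.integral_const_mul _ _

theorem hasDerivAt_gaussWave (ξ t : ℝ) :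
    HasDerivAt (gaussWave ξ)
      (gaussWave ξ t * (-Real.pi * t - 2 * Real.pi * Complex.I * ξ)) t := by
  have h : HasDerivAt (fun s : ℂ => Complex.exp (-(Real.pi / 2) * s ^ 2 -
      2 * Real.pi * Complex.I * ξ * s)) (Complex.exp (-(Real.pi / 2) * (t : ℂ) ^ 2 -
      2 * Real.pi * Complex.I * ξ * t) * (-Real.pi * t - 2 * Real.pi * Complex.I * ξ)) (t : ℂ) := by
    refine HasDerivAt.cexp ?_
    refine (((hasDerivAt_pow 2 (t : ℂ)).const_mul (-(Real.pi / 2) : ℂ)).sub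
      ((hasDerivAt_id' (t : ℂ)).const_mul (2 * Real.pi * Complex.I * ξ : ℂ))).congr_deriv ?_
    push_cast
    ring
  exact h.comp_ofReal

/-- Integration by parts for Gaussian moments. -/
theorem gaussMoment_X_mul (x ξ : ℝ) (P : Polynomial ℂ) :
    gaussMoment x ξ (Polynomial.X * P) = (x + ξ * Complex.I) * gaussMoment x ξ P +
      (1 / (4 * Real.pi)) * gaussMoment x ξ (Polynomial.derivative P) := by
  have hpi : (Real.pi : ℂ) ≠ 0 := Complex.ofReal_ne_zero.2 Real.pi_ne_zero
  -- With u = x - t/2 one has -πt = 2π(u - x), so R(u) times the wave is the t-derivative of P(u)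
  -- times the wave.
  set R : Polynomial ℂ := Polynomial.C (2 * Real.pi : ℂ) * (Polynomial.X * P) +
    (Polynomial.C (-(2 * Real.pi) * (x + ξ * Complex.I)) * P +
      Polynomial.C (-1 / 2) * Polynomial.derivative P) with hR
  have hderiv : ∀ t : ℝ, HasDerivAt (fun t : ℝ => P.eval ((x : ℂ) - t / 2) * gaussWave ξ t)
      (R.eval ((x : ℂ) - t / 2) * gaussWave ξ t) t := by
    intro t
    have h1 : HasDerivAt (fun s : ℂ => P.eval ((x : ℂ) - s / 2))
        ((Polynomial.derivative P).eval ((x : ℂ) - t / 2) * (-(1 / 2))) (t : ℂ) :=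
      HasDerivAt.comp (h₂ := fun u => P.eval u) (t : ℂ) (P.hasDerivAt ((x : ℂ) - t / 2))
        (((hasDerivAt_id' (t : ℂ)).div_const 2).const_sub (x : ℂ))
    refine (h1.comp_ofReal.mul (hasDerivAt_gaussWave ξ t)).congr_deriv ?_
    simp only [hR, Polynomial.eval_add, Polynomial.eval_mul, Polynomial.eval_C, Polynomial.eval_X]
    ring
  have h0 : gaussMoment x ξ R = 0 :=
    MeasureTheory.integral_eq_zero_of_hasDerivAt_of_integrable hderiv
      (integrable_eval_shift_mul_gaussWave x ξ R) (integrable_eval_shift_mul_gaussWave x ξ P)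
  rw [hR, gaussMoment_add, gaussMoment_add, gaussMoment_C_mul, gaussMoment_C_mul,
    gaussMoment_C_mul] at h0
  field_simp
  linear_combination 2 * h0

theorem gaussMoment_X_pow (x ξ : ℝ) (m : ℕ) :
    gaussMoment x ξ (Polynomial.X ^ m) =
      (gaussAppell (1 / (4 * Real.pi)) m).eval (x + ξ * Complex.I : ℂ) * gaussMoment x ξ 1 := by
  induction m using Nat.strong_induction_on with
  | _ m ih =>
    rcases m with _ | _ | m
    · simp [gaussAppell]
    · rw [pow_succ', gaussMoment_X_mul]
      simp [gaussAppell, gaussMoment]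
    · rw [pow_succ', gaussMoment_X_mul, Polynomial.derivative_X_pow, gaussMoment_C_mul,
        ih (m + 1) (by omega), Nat.add_sub_cancel, ih m (by omega), gaussAppell.eq_2 _ (m + 1),
        derivative_gaussAppell_succ]
      simp only [Polynomial.eval_add, Polynomial.eval_mul, Polynomial.eval_C, Polynomial.eval_X,
        Polynomial.eval_natCast]
      ring

theorem gaussMoment_eq (x ξ : ℝ) (P : Polynomial ℂ) :
    gaussMoment x ξ P =
      (gaussTransform (1 / (4 * Real.pi)) P).eval (x + ξ * Complex.I : ℂ) *
        gaussMoment x ξ 1 := by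
  induction P using Polynomial.induction_on' with
  | add p q hp hq =>
    rw [gaussMoment_add, hp, hq, gaussTransform_add, Polynomial.eval_add]
    ring
  | monomial n a =>
    rw [gaussTransform_monomial, ← Polynomial.C_mul_X_pow_eq_monomial, gaussMoment_C_mul,
      gaussMoment_X_pow, Polynomial.eval_mul, Polynomial.eval_C]
    ring

/-! ### Wigner distributions of polynomials times Gaussians -/

/-- The function `P(t) e^{-π t²}`. -/
noncomputable def polyGauss (P : Polynomial ℂ) (t : ℝ) : ℂ :=
  P.eval (t : ℂ) * Real.exp (-Real.pi * t ^ 2)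

theorem wigner_affine_polyGauss (a b : ℂ) (q : Polynomial ℂ) (x ξ : ℝ) :
    wigner (polyGauss (Polynomial.C a + Polynomial.C b * Polynomial.X)) (polyGauss q) x ξ =
      Real.exp (-2 * Real.pi * x ^ 2) * gaussMoment x ξ 1 *
        ((a + b * conj (x + ξ * Complex.I : ℂ)) *
            (gaussTransform (1 / (4 * Real.pi)) (q.map (starRingEnd ℂ))).eval
              (x + ξ * Complex.I : ℂ) -
          b * (1 / (4 * Real.pi)) * (Polynomial.derivative
            (gaussTransform (1 / (4 * Real.pi)) (q.map (starRingEnd ℂ)))).eval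
              (x + ξ * Complex.I : ℂ)) := by
  set Q := q.map (starRingEnd ℂ) with hQ
  -- Here a + b(x + t/2) is rewritten as (a + 2bx) - b(x - t/2).
  have h1 : wigner (polyGauss (Polynomial.C a + Polynomial.C b * Polynomial.X)) (polyGauss q) x ξ =
      Real.exp (-2 * Real.pi * x ^ 2) * gaussMoment x ξ
        (Polynomial.C (a + 2 * b * x) * Q + Polynomial.C (-b) * (Polynomial.X * Q)) := by
    rw [wigner, gaussMoment, ← MeasureTheory.integral_const_mul]
    refine MeasureTheory.integral_congr_ae (Filter.Eventually.of_forall fun t => ?_)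
    have hconj : conj (q.eval ((x : ℂ) - t / 2)) = Q.eval ((x : ℂ) - t / 2) := by
      rw [hQ, Polynomial.eval_map, Polynomial.eval, Polynomial.hom_eval₂, RingHom.comp_id, map_sub,
        map_div₀, Complex.conj_ofReal, Complex.conj_ofReal, map_ofNat]
    have hexp : Complex.exp (-Real.pi * ((x : ℂ) + t / 2) ^ 2) *
        Complex.exp (-Real.pi * ((x : ℂ) - t / 2) ^ 2) *
        Complex.exp (-2 * Real.pi * Complex.I * ξ * t) =
        Complex.exp (-2 * Real.pi * x ^ 2) * gaussWave ξ t := by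
      rw [gaussWave, ← Complex.exp_add, ← Complex.exp_add, ← Complex.exp_add]
      congr 1
      ring
    simp only [polyGauss, map_mul, Complex.conj_ofReal, Polynomial.eval_add, Polynomial.eval_mul,
      Polynomial.eval_C, Polynomial.eval_X]
    push_cast
    rw [hconj]
    linear_combination (a + b * ((x : ℂ) + t / 2)) * Q.eval ((x : ℂ) - t / 2) * hexp
  rw [h1, gaussMoment_add, gaussMoment_C_mul, gaussMoment_C_mul, gaussMoment_eq x ξ Q,
    gaussMoment_eq x ξ (Polynomial.X * Q), gaussTransform_X_mul]
  simp only [Polynomial.eval_add, Polynomial.eval_mul, Polynomial.eval_C, Polynomial.eval_X,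
    map_add, map_mul, Complex.conj_ofReal, Complex.conj_I]
  ring

/-- Substitute t ↦ -t. Zeros are thus symmetric in f and g, so the affine factor may be taken to be
f. -/
theorem wigner_swap (f g : ℝ → ℂ) (x ξ : ℝ) : wigner g f x ξ = conj (wigner f g x ξ) := by
  unfold wigner
  rw [← integral_conj, ← MeasureTheory.integral_neg_eq_self]
  refine MeasureTheory.integral_congr_ae (Filter.Eventually.of_forall fun t => ?_)
  simp only [map_mul, Complex.conj_conj, ← Complex.exp_conj, map_neg, Complex.conj_ofReal,
    Complex.conj_I, map_ofNat, Complex.ofReal_neg, neg_div, sub_neg_eq_add, ← sub_eq_add_neg]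
  ring_nf

/-! ### Critical points of Gaussian-weighted polynomials -/

theorem tendsto_eval_mul_gauss_cocompact (P : Polynomial ℂ) {k : ℝ} (hk : 0 < k) :
    Filter.Tendsto (fun z : ℂ => P.eval z * Real.exp (-k * ‖z‖ ^ 2))
      (Filter.cocompact ℂ) (nhds 0) := by
  induction P using Polynomial.induction_on' with
  | add p q hp hq => simpa [add_mul] using hp.add hq
  | monomial n a =>
    have h1 : Filter.Tendsto (fun r : ℝ => r ^ n * Real.exp (-k * r ^ 2)) Filter.atTop
        (nhds 0) := by
      have h := (rpow_mul_exp_neg_mul_sq_isLittleO_exp_neg hk (n : ℝ)).trans_tendsto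
        (Real.tendsto_exp_atBot.comp
          (Filter.tendsto_id.const_mul_atTop_of_neg (by norm_num : -(1 / 2 : ℝ) < 0)))
      simpa using h
    have h2 := h1.comp (tendsto_norm_cocompact_atTop (E := ℂ))
    have h3 : Filter.Tendsto (fun z : ℂ => z ^ n * (Real.exp (-k * ‖z‖ ^ 2) : ℂ))
        (Filter.cocompact ℂ) (nhds 0) := by
      rw [tendsto_zero_iff_norm_tendsto_zero]
      refine h2.congr fun z => ?_
      rw [norm_mul, norm_pow, Complex.norm_real, Real.norm_eq_abs, Real.abs_exp]
      rfl
    simpa [mul_assoc] using h3.const_mul a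

/-- A Gaussian-weighted nonzero polynomial has a critical point where it does not vanish. -/
theorem exists_conj_mul_eval_eq_derivative {P : Polynomial ℂ} (hP : P ≠ 0) {k : ℝ} (hk : 0 < k) :
    ∃ z : ℂ, k * conj z * P.eval z = (Polynomial.derivative P).eval z := by
  set F : ℂ → ℝ := fun z => Complex.normSq (P.eval z) * Real.exp (-k * Complex.normSq z) with hF
  have hFn : ∀ z, F z = ‖P.eval z * Real.exp (-(k / 2) * ‖z‖ ^ 2)‖ ^ 2 := by
    intro z
    rw [norm_mul, Complex.norm_real, Real.norm_eq_abs, Real.abs_exp, mul_pow, ← Real.exp_nat_mul,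
      ← Complex.normSq_eq_norm_sq, ← Complex.normSq_eq_norm_sq]
    simp only [hF]
    congr 2
    push_cast
    ring
  have hlim : Filter.Tendsto F (Filter.cocompact ℂ) (nhds 0) := by
    have h := ((tendsto_eval_mul_gauss_cocompact P (half_pos hk)).norm).pow 2
    rw [norm_zero, zero_pow two_ne_zero] at h
    exact h.congr fun z => (hFn z).symm
  have hcont : Continuous F := by
    have := Complex.continuous_normSq
    have := P.continuous
    fun_prop
  obtain ⟨z₁, hz₁⟩ : ∃ z, P.eval z ≠ 0 := by
    by_contra! h
    exact hP (Polynomial.funext fun z => by simp [h z])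
  have hpos : 0 < F z₁ := mul_pos (Complex.normSq_pos.2 hz₁) (Real.exp_pos _)
  -- Outside a compact set `F` stays below its positive value at `z₁`, so a global maximum exists.
  obtain ⟨z, hz⟩ := hcont.exists_forall_ge' z₁
    ((hlim.eventually (gt_mem_nhds hpos)).mono fun _ h => h.le)
  have hPz : P.eval z ≠ 0 := by
    intro h
    have := hz z₁
    simp only [hF, h, map_zero, zero_mul] at this hpos
    linarith
  refine ⟨z, ?_⟩
  -- `X` is conj(P(z)) times the difference to be killed. Along a direction v the derivative of `F`
  -- is 2 exp(-k|z|²) Re(Xv); taking v = conj X makes it a positive multiple of |X|².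
  set X : ℂ := conj (P.eval z) * (Polynomial.derivative P).eval z -
    k * Complex.normSq (P.eval z) * conj z with hX
  set v : ℂ := conj X with hv
  have hline : HasDerivAt (fun s : ℂ => z + s * v) v ((0 : ℝ) : ℂ) := by
    simpa using ((hasDerivAt_id (((0 : ℝ) : ℂ))).mul_const v).const_add z
  have hnsq : ∀ {u : ℝ → ℂ} {u' : ℂ}, HasDerivAt u u' 0 →
      HasDerivAt (fun s => Complex.normSq (u s)) (2 * (conj (u 0) * u').re) 0 := by
    intro u u' hu
    have hre : HasDerivAt (fun s => (u s).re) u'.re 0 :=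
      Complex.reCLM.hasFDerivAt.comp_hasDerivAt (0 : ℝ) hu
    have him : HasDerivAt (fun s => (u s).im) u'.im 0 :=
      Complex.imCLM.hasFDerivAt.comp_hasDerivAt (0 : ℝ) hu
    refine ((hre.mul hre).add (him.mul him)).congr_deriv ?_
    simp only [Complex.mul_re, Complex.conj_re, Complex.conj_im]
    ring
  have h1 := hnsq hline.comp_ofReal
  have h2 : HasDerivAt (fun s : ℝ => P.eval (z + s * v))
      ((Polynomial.derivative P).eval z * v) 0 := by
    have h := (P.hasDerivAt (z + ((0 : ℝ) : ℂ) * v)).comp ((0 : ℝ) : ℂ) hline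
    simpa using h.comp_ofReal
  have h3 := (hnsq h2).mul ((h1.const_mul (-k)).exp)
  have h4 : IsLocalMax (fun s : ℝ => Complex.normSq (P.eval (z + s * v)) *
      Real.exp (-k * Complex.normSq (z + s * v))) 0 := by
    refine Filter.Eventually.of_forall fun s => ?_
    have := hz (z + s * v)
    simpa [hF] using this
  have h5 := h4.hasDerivAt_eq_zero h3
  simp only [Complex.ofReal_zero, zero_mul, add_zero] at h5
  have h6 : (X * v).re = 0 := by
    have h7 : (X * v).re = (conj (P.eval z) * ((Polynomial.derivative P).eval z * v)).re -
        k * Complex.normSq (P.eval z) * (conj z * v).re := by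
      rw [hX, sub_mul, Complex.sub_re, mul_assoc, ← Complex.ofReal_mul, mul_assoc,
        Complex.re_ofReal_mul]
    have h8 : 2 * Real.exp (-k * Complex.normSq z) * (X * v).re = 0 := by
      rw [h7]
      linear_combination h5
    have := Real.exp_pos (-k * Complex.normSq z)
    rcases mul_eq_zero.1 h8 with h | h
    · linarith
    · exact h
  rw [hv, Complex.mul_conj, Complex.ofReal_re, Complex.normSq_eq_zero, hX,
    Complex.normSq_eq_conj_mul_self] at h6
  have hc : conj (P.eval z) ≠ 0 := by simpa using hPz
  apply mul_left_cancel₀ hc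
  linear_combination -h6

/-- Translating the variable by conj α moves the centre of the Gaussian weight. -/
theorem exists_affine_conj_mul_eval_eq_derivative {P : Polynomial ℂ} (hP : P ≠ 0) {k : ℝ}
    (hk : 0 < k) (α : ℂ) :
    ∃ z : ℂ, k * (α + conj z) * P.eval z = (Polynomial.derivative P).eval z := by
  have hne : P.comp (Polynomial.X + Polynomial.C (-conj α)) ≠ 0 := by
    rw [Ne, Polynomial.comp_X_add_C_eq_zero_iff]
    exact hP
  obtain ⟨w, hw⟩ := exists_conj_mul_eval_eq_derivative hne hk
  refine ⟨w + -conj α, ?_⟩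
  rw [Polynomial.derivative_comp] at hw
  simp only [Polynomial.eval_comp, Polynomial.eval_add, Polynomial.eval_X,
    Polynomial.eval_C, Polynomial.derivative_add, Polynomial.derivative_X,
    Polynomial.derivative_C, add_zero, one_mul] at hw
  rw [← hw]
  simp

theorem exists_wigner_affine_polyGauss_eq_zero (a b : ℂ) (q : Polynomial ℂ)
    (h : ¬ (b = 0 ∧ q.natDegree = 0)) :
    ∃ x ξ : ℝ, wigner (polyGauss (Polynomial.C a + Polynomial.C b * Polynomial.X))
      (polyGauss q) x ξ = 0 := by
  set Q := q.map (starRingEnd ℂ) with hQ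
  set G := gaussTransform (1 / (4 * Real.pi)) Q with hG
  have hpi : (Real.pi : ℂ) ≠ 0 := Complex.ofReal_ne_zero.2 Real.pi_ne_zero
  suffices hz : ∃ z : ℂ, (a + b * conj z) * G.eval z -
      b * (1 / (4 * Real.pi)) * (Polynomial.derivative G).eval z = 0 by
    obtain ⟨z, hz⟩ := hz
    refine ⟨z.re, z.im, ?_⟩
    rw [wigner_affine_polyGauss, Complex.re_add_im, hz, mul_zero]
  have hcoeff : G.coeff Q.natDegree = Q.leadingCoeff := coeff_gaussTransform_natDegree _ _
  by_cases hG0 : G = 0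
  · exact ⟨0, by simp [hG0]⟩
  by_cases hb : b = 0
  · have hdeg : Q.natDegree ≠ 0 := by
      rw [hQ, Polynomial.natDegree_map]
      exact fun h' => h ⟨hb, h'⟩
    -- The coefficient of `G` in degree `Q.natDegree` > 0 is the leading coefficient of `Q`, which
    -- is nonzero.
    have hGdeg : G.degree ≠ 0 := by
      intro hd
      rw [Polynomial.coeff_eq_zero_of_degree_lt] at hcoeff
      · have hQ0 := Polynomial.leadingCoeff_eq_zero.1 hcoeff.symm
        exact hdeg (by rw [hQ0, Polynomial.natDegree_zero])
      · rw [hd]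
        exact_mod_cast Nat.pos_of_ne_zero hdeg
    obtain ⟨z, hz⟩ := IsAlgClosed.exists_root G hGdeg
    exact ⟨z, by rw [hb, hz.eq_zero]; ring⟩
  · obtain ⟨z, hz⟩ := exists_affine_conj_mul_eval_eq_derivative hG0
      (by positivity : 0 < 4 * Real.pi) (a / b)
    refine ⟨z, ?_⟩
    rw [← hz]
    push_cast
    field_simp
    ring

/-! ### Hermite functions as polynomials times Gaussians -/

theorem exists_iteratedDeriv_gauss_eq (j : ℕ) : ∃ P : Polynomial ℝ,
    iteratedDeriv j (fun s : ℝ => Real.exp (-2 * Real.pi * s ^ 2)) =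
      fun t => P.eval t * Real.exp (-2 * Real.pi * t ^ 2) := by
  induction j with
  | zero => exact ⟨1, by simp⟩
  | succ j ih =>
    obtain ⟨P, hP⟩ := ih
    refine ⟨Polynomial.derivative P - Polynomial.C (4 * Real.pi) * Polynomial.X * P, ?_⟩
    rw [iteratedDeriv_succ, hP]
    funext t
    have h := (P.hasDerivAt t).fun_mul (((hasDerivAt_pow 2 t).const_mul (-2 * Real.pi)).exp)
    rw [HasDerivAt.deriv h]
    simp only [Polynomial.eval_sub, Polynomial.eval_mul, Polynomial.eval_C, Polynomial.eval_X]
    push_cast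
    ring

theorem exists_hermiteFun_eq_polyGauss (j : ℕ) : ∃ P : Polynomial ℂ, hermiteFun j = polyGauss P := by
  obtain ⟨P, hP⟩ := exists_iteratedDeriv_gauss_eq j
  refine ⟨Polynomial.C (((-1) ^ j / Real.sqrt (∫ s : ℝ, rawHermite j s ^ 2) : ℝ) : ℂ) *
    P.map Complex.ofRealHom, ?_⟩
  funext t
  have h1 : rawHermite j t = (-1) ^ j * P.eval t * Real.exp (-Real.pi * t ^ 2) := by
    have h2 : Real.exp (Real.pi * t ^ 2) * Real.exp (-2 * Real.pi * t ^ 2) =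
        Real.exp (-Real.pi * t ^ 2) := by
      rw [← Real.exp_add]
      congr 1
      ring
    rw [rawHermite, hP, ← h2]
    ring
  have h3 : (P.map Complex.ofRealHom).eval (t : ℂ) = ((P.eval t : ℝ) : ℂ) :=
    Polynomial.eval_map_apply Complex.ofRealHom t
  rw [hermiteFun, h1, polyGauss, Polynomial.eval_mul, Polynomial.eval_C, h3]
  push_cast
  ring

/-- The value of c plays no role: only the affine form of combinations of h_0 and h_1 is used. -/
theorem exists_hermiteFun_one_eq : ∃ c : ℂ,
    hermiteFun 1 = polyGauss (Polynomial.C c * Polynomial.X) := by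
  refine ⟨((4 * Real.pi / Real.sqrt (∫ s : ℝ, rawHermite 1 s ^ 2) : ℝ) : ℂ), ?_⟩
  funext t
  have h1 : rawHermite 1 t = 4 * Real.pi * t * Real.exp (-Real.pi * t ^ 2) := by
    have h2 : Real.exp (Real.pi * t ^ 2) * Real.exp (-2 * Real.pi * t ^ 2) =
        Real.exp (-Real.pi * t ^ 2) := by
      rw [← Real.exp_add]
      congr 1
      ring
    have h := ((hasDerivAt_pow 2 t).const_mul (-2 * Real.pi)).exp
    rw [rawHermite, iteratedDeriv_one, h.deriv, ← h2]
    push_cast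
    ring
  rw [hermiteFun, h1, polyGauss, Polynomial.eval_mul, Polynomial.eval_C, Polynomial.eval_X]
  push_cast
  ring

theorem hermiteFun_zero_eq_polyGauss :
    hermiteFun 0 = polyGauss (Polynomial.C (((2 : ℝ) ^ (1 / 4 : ℝ) : ℝ) : ℂ)) := by
  funext t
  rw [hermiteFun_zero, polyGauss, Polynomial.eval_C, Complex.ofReal_mul]

theorem exists_eq_smul_hermiteFun_zero (a : ℂ) :
    ∃ c : ℂ, polyGauss (Polynomial.C a) = c • hermiteFun 0 := by
  have h2 : (((2 : ℝ) ^ (1 / 4 : ℝ) : ℝ) : ℂ) ≠ 0 :=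
    Complex.ofReal_ne_zero.2 (Real.rpow_pos_of_pos (by norm_num) _).ne'
  refine ⟨a / (((2 : ℝ) ^ (1 / 4 : ℝ) : ℝ) : ℂ), ?_⟩
  rw [hermiteFun_zero_eq_polyGauss]
  funext t
  rw [Pi.smul_apply, smul_eq_mul, polyGauss, polyGauss, Polynomial.eval_C, Polynomial.eval_C,
    ← mul_assoc, div_mul_cancel₀ _ h2]

theorem exists_eq_polyGauss_of_mem_span {f : ℝ → ℂ}
    (hf : f ∈ Submodule.span ℂ (Set.range hermiteFun)) : ∃ P, f = polyGauss P := by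
  induction hf using Submodule.span_induction with
  | mem f h =>
    obtain ⟨j, rfl⟩ := h
    exact exists_hermiteFun_eq_polyGauss j
  | zero => exact ⟨0, by funext t; simp [polyGauss]⟩
  | add f g _ _ hf hg =>
    obtain ⟨P, rfl⟩ := hf
    obtain ⟨Q, rfl⟩ := hg
    exact ⟨P + Q, by funext t; simp [polyGauss, add_mul]⟩
  | smul a f _ hf =>
    obtain ⟨P, rfl⟩ := hf
    exact ⟨Polynomial.C a * P, by funext t; simp [polyGauss, mul_assoc]⟩

theorem exists_eq_polyGauss_affine_of_mem_span {f : ℝ → ℂ}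
    (hf : f ∈ Submodule.span ℂ {hermiteFun 0, hermiteFun 1}) :
    ∃ a b : ℂ, f = polyGauss (Polynomial.C a + Polynomial.C b * Polynomial.X) := by
  obtain ⟨r, s, rfl⟩ := Submodule.mem_span_pair.1 hf
  obtain ⟨c, hc⟩ := exists_hermiteFun_one_eq
  refine ⟨r * (((2 : ℝ) ^ (1 / 4 : ℝ) : ℝ) : ℂ), s * c, ?_⟩
  rw [hc, hermiteFun_zero_eq_polyGauss]
  funext t
  simp only [polyGauss, Pi.add_apply, Pi.smul_apply, smul_eq_mul, Polynomial.eval_add,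
    Polynomial.eval_mul, Polynomial.eval_C, Polynomial.eval_X]
  ring

theorem exists_wigner_eq_zero_of_mem_span {f g : ℝ → ℂ}
    (hf : f ∈ Submodule.span ℂ {hermiteFun 0, hermiteFun 1})
    (hg : g ∈ Submodule.span ℂ (Set.range hermiteFun))
    (hne : ¬ ((∃ a : ℂ, f = a • hermiteFun 0) ∧ (∃ b : ℂ, g = b • hermiteFun 0))) :
    ∃ x ξ : ℝ, wigner f g x ξ = 0 := by
  obtain ⟨a, b, rfl⟩ := exists_eq_polyGauss_affine_of_mem_span hf
  obtain ⟨q, rfl⟩ := exists_eq_polyGauss_of_mem_span hg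
  -- The exceptional case b = 0, q constant is one where both functions are multiples of h_0.
  refine exists_wigner_affine_polyGauss_eq_zero a b q fun ⟨hb, hq⟩ => hne ⟨?_, ?_⟩
  · rw [hb, Polynomial.C_0, zero_mul, add_zero]
    exact exists_eq_smul_hermiteFun_zero a
  · rw [Polynomial.eq_C_of_natDegree_eq_zero hq]
    exact exists_eq_smul_hermiteFun_zero _

theorem mainTheorem9 (f g : ℝ → ℂ)
    (hf : f ∈ Submodule.span ℂ (Set.range hermiteFun))
    (hg : g ∈ Submodule.span ℂ (Set.range hermiteFun))
    (hfg : f ∈ Submodule.span ℂ {hermiteFun 0, hermiteFun 1} ∨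
      g ∈ Submodule.span ℂ {hermiteFun 0, hermiteFun 1})
    (hne : ¬ ((∃ a : ℂ, f = a • hermiteFun 0) ∧ (∃ b : ℂ, g = b • hermiteFun 0))) :
    ∃ x ξ : ℝ, wigner f g x ξ = 0 := by
  rcases hfg with h | h
  · exact exists_wigner_eq_zero_of_mem_span h hg hne
  · obtain ⟨x, ξ, hz⟩ := exists_wigner_eq_zero_of_mem_span h hf fun h' => hne h'.symm
    exact ⟨x, ξ, by rw [wigner_swap, hz, map_zero]⟩
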